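/- **Theorem 2 (learning guarantee for PU empirical risk minimization).** Let $(X,Y)$ be a random pair with $X$ in a measurable space $\mathcal X$ (for instance $\mathbb R^d$) and $Y\in\{\pm1\}$, let $\pi=P(Y=+1)>0$, let $p_+$ be the conditional law of $X$ given $Y=+1$ and $p$ the marginal law of $X$. Let $\ell:\mathbb R\times\{\pm1\}\to[0,1]$ be a loss such that $\ell(\cdot,y)$ is $L_\ell$-Lipschitz for each $y$ and $$\ell(t,+1)+\ell(t,-1)=1\qquad\text{for all }t\in\mathbb R .$$ Write $R(g)=\mathbb E[\ell(g(X),Y)]$ and $I(g)=\mathbb E[\ell_{01}(g(X),Y)]$ with $\ell_{01}(t,y)=(1-\operatorname{sign}(ty))/2$, and let $R^*=\inf_g R(g)$ and $I^*=\inf_g I(g)$, the infima being over all measurable $g:\mathcal X\to\mathbb R$. Let $\mathcal G$ be a class of measurable functions $\mathcal X\to\mathbb R$ that is pointwise measurable (it has a countable subclass such that every $g\in\mathcal G$ is the pointwise limit of a sequence from the subclass), and let $g^*$ be a minimizer of $R$ over $\mathcal G$. Let $n_+,n_{\mathrm u}\ge1$, and let $x_1,\dots,x_{n_+}\sim p_+$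 and $x'_1,\dots,x'_{n_{\mathrm u}}\sim p$ be independent. Let $\hat g_{\mathrm{pu}}$ be an arbitrary minimizer over $\mathcal G$ of $$\widehat R_{\mathrm{pu}}(g)=-\pi+\frac{2\pi}{n_+}\sum_{i=1}^{n_+}\ell(g(x_i),+1)+\frac1{n_{\mathrm u}}\sum_{j=1}^{n_{\mathrm u}}\ell(g(x'_j),-1).$$ For a law $q$ on $\mathcal X$ let $$\mathfrak R_{n,q}(\mathcal G)=\mathbb E_{z_1,\dots,z_n\sim q}\,\mathbb E_\sigma\Big[\sup_{g\in\mathcal G}\frac1n\sum_{i=1}^n\sigma_i g(z_i)\Big],$$ where $z_1,\dots,z_n$ are independent with law $q$ and $\sigma_1,\dots,\sigma_n$ are independent uniform signs, and assume that $\mathfrak R_{n_+,p_+}(\mathcal G)$ and $\mathfrak R_{n_{\mathrm u},p}(\mathcal G)$ are finite. For $\delta>0$ put $$B_\delta=8\pi L_\ell\,\mathfrak R_{n_+,p_+}(\mathcal G)+4L_\ell\,\mathfrak R_{n_{\mathrm u},p}(\mathcal G)+2\pi\sqrt{\frac{2\ln(4/\delta)}{n_+}}+\sqrt{\frac{2\ln(4/\delta)}{n_{\mathrm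 u}}} ,$$ where the square root of a negative number, which occurs only for $\delta>4$, is read as $0$. 1. For every $\delta>0$, with probability at least $1-\delta$ over the two samples, every such minimizer satisfies $R(\hat g_{\mathrm{pu}})-R(g^*)\le B_\delta$. 2. Suppose moreover that $\ell$ is classification-calibrated, that is, for every $\eta\in[0,1]$ with $\eta\ne\frac12$, $$\inf_{t\in\mathbb R}C_\eta(t)<\inf_{t:\,t(2\eta-1)\le0}C_\eta(t),\qquad C_\eta(t)=\eta\,\ell(t,+1)+(1-\eta)\,\ell(t,-1).$$ Then there is a continuous nondecreasing $\varphi:\mathbb R\to\mathbb R$ with $\varphi(0)=0$, not depending on the law of $(X,Y)$, on $\mathcal G$, on the sample sizes or on $\delta$, such that for every $\delta>0$, with probability at least $1-\delta$, every such minimizer satisfies $I(\hat g_{\mathrm{pu}})-I^*\le\varphi\big(R(g^*)-R^*+B_\delta\big)$. -/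

import Mathlib

open MeasureTheory ProbabilityTheory Filter Topology
open scoped NNReal ENNReal

universe u

noncomputable section

namespace PULearning

/-! Labels are elements of `ℤˣ = {1, -1}`; a loss is a function `ℓ : ℝ → ℤˣ → ℝ`, and the
population is a probability measure `ρ` on `X × ℤˣ`, the law of `(X, Y)`. -/

/-- The zero-one loss `(1 - sign (t y)) / 2`; in particular it equals `1/2` at `t = 0`. -/
def zeroOneLoss (t : ℝ) (y : ℤˣ) : ℝ :=
  (1 - Real.sign (t * ((y : ℤ) : ℝ))) / 2

/-- The conditional risk of predicting `t` where the positive label has probability `η`. -/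
def conditionalRisk (ℓ : ℝ → ℤˣ → ℝ) (η t : ℝ) : ℝ :=
  η * ℓ t 1 + (1 - η) * ℓ t (-1)

/-- Classification calibration in the sense of Bartlett, Jordan and McAuliffe: for every
`η ≠ 1/2`, predicting with a sign other than that of the Bayes rule is strictly suboptimal for
the conditional risk. (To be used for losses bounded below.) -/
def IsClassificationCalibrated (ℓ : ℝ → ℤˣ → ℝ) : Prop :=
  ∀ η ∈ Set.Icc (0 : ℝ) 1, η ≠ 1 / 2 →
    (⨅ t : ℝ, conditionalRisk ℓ η t) <
      ⨅ t : {t : ℝ // t * (2 * η - 1) ≤ 0}, conditionalRisk ℓ η t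

section Population

variable {X : Type u} [MeasurableSpace X]

/-- The class prior `P(Y = +1)`. -/
def classPrior (ρ : Measure (X × ℤˣ)) : ℝ :=
  ρ.real {z | z.2 = 1}

/-- The marginal law of `X`. -/
def marginal (ρ : Measure (X × ℤˣ)) : Measure X :=
  ρ.map Prod.fst

/-- The conditional law of `X` given `Y = +1`. -/
def posMarginal (ρ : Measure (X × ℤˣ)) : Measure X :=
  (ProbabilityTheory.cond ρ {z | z.2 = 1}).map Prod.fst

/-- The risk `E[ℓ(g(X), Y)]`. -/
def risk (ℓ : ℝ → ℤˣ → ℝ) (ρ : Measure (X × ℤˣ)) (g : X → ℝ) : ℝ :=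
  ∫ z, ℓ (g z.1) z.2 ∂ρ

/-- The Bayes risk: the infimum of the risk over all measurable functions. -/
def bayesRisk (ℓ : ℝ → ℤˣ → ℝ) (ρ : Measure (X × ℤˣ)) : ℝ :=
  ⨅ g : {g : X → ℝ // Measurable g}, risk ℓ ρ g

/-- The law of the training data: `nP` points from the positive class-conditional law and `nU`
unlabeled points from the marginal law, all independent. -/
def sampleLaw (ρ : Measure (X × ℤˣ)) (nP nU : ℕ) : Measure ((Fin nP → X) × (Fin nU → X)) :=
  (Measure.pi fun _ : Fin nP => posMarginal ρ).prod (Measure.pi fun _ : Fin nU => marginal ρ)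

/-- The empirical PU risk with class prior `prior`, computed from a positive sample `S.1` and an
unlabeled sample `S.2`. -/
def empiricalPURisk (ℓ : ℝ → ℤˣ → ℝ) (prior : ℝ) {nP nU : ℕ}
    (S : (Fin nP → X) × (Fin nU → X)) (g : X → ℝ) : ℝ :=
  -prior + 2 * prior / nP * ∑ i, ℓ (g (S.1 i)) 1 + 1 / nU * ∑ j, ℓ (g (S.2 j)) (-1)

/-- `h` is a global minimizer of `F` over the function class `G`. -/
def IsMinimizer (F : (X → ℝ) → ℝ) (G : Set (X → ℝ)) (h : X → ℝ) : Prop :=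
  h ∈ G ∧ ∀ g ∈ G, F h ≤ F g

/-- The class `G` consists of measurable functions and is pointwise measurable: it has a countable
subclass such that each member of `G` is the pointwise limit of a sequence in that subclass. -/
def IsPointwiseMeasurable (G : Set (X → ℝ)) : Prop :=
  (∀ g ∈ G, Measurable g) ∧
    ∃ G₀ ⊆ G, G₀.Countable ∧ ∀ g ∈ G, ∃ u : ℕ → X → ℝ,
      (∀ k, u k ∈ G₀) ∧ ∀ x, Tendsto (fun k => u k x) atTop (𝓝 (g x))

end Population

section Rademacher

/-- The empirical Rademacher complexity: the average over all sign vectors `σ ∈ {1, -1}ⁿ` of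
`sup_{g ∈ G} (1/n) ∑ i, σ i * g (x i)`, the supremum being taken in the extended reals. -/
def empiricalRademacher {X : Type u} (G : Set (X → ℝ)) {n : ℕ} (x : Fin n → X) : EReal :=
  ((((2 : ℝ) ^ n)⁻¹ : ℝ) : EReal) *
    ∑ σ : Fin n → ℤˣ, ⨆ g ∈ G, ((1 / n * ∑ i, ((σ i : ℤ) : ℝ) * g (x i) : ℝ) : EReal)

/-- For a nonempty class the empirical Rademacher complexity is nonnegative, so passing to
`ℝ≥0∞` below loses nothing. -/
theorem empiricalRademacher_nonneg {X : Type u} {G : Set (X → ℝ)} (hG : G.Nonempty) {n : ℕ}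
    (x : Fin n → X) : 0 ≤ empiricalRademacher G x := by
  obtain ⟨g, hg⟩ := hG
  refine mul_nonneg (by exact_mod_cast (by positivity : (0 : ℝ) ≤ ((2 : ℝ) ^ n)⁻¹)) ?_
  have h1 : (0 : ℝ) = ∑ σ : Fin n → ℤˣ, (1 / n * ∑ i, ((σ i : ℤ) : ℝ) * g (x i) : ℝ) := by
    have h := Equiv.sum_comp (Equiv.neg (Fin n → ℤˣ))
      (fun σ : Fin n → ℤˣ => (1 / n * ∑ i, ((σ i : ℤ) : ℝ) * g (x i) : ℝ))
    simp only [Equiv.neg_apply, Pi.neg_apply, Units.val_neg, Int.cast_neg, neg_mul,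
      Finset.sum_neg_distrib, mul_neg] at h
    linarith
  calc (0 : EReal) = ((0 : ℝ) : EReal) := rfl
    _ = ∑ σ : Fin n → ℤˣ, ((1 / n * ∑ i, ((σ i : ℤ) : ℝ) * g (x i) : ℝ) : EReal) := by
        rw [h1]
        exact map_sum (⟨⟨Real.toEReal, rfl⟩, EReal.coe_add⟩ : ℝ →+ EReal) _ _
    _ ≤ _ := Finset.sum_le_sum fun σ _ => le_iSup₂_of_le g hg le_rfl

/-- The Rademacher complexity of `G` for the sampling of size `n` from `q`. -/
def rademacherComplexity {X : Type u} [MeasurableSpace X] (n : ℕ) (q : Measure X)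
    (G : Set (X → ℝ)) : ℝ≥0∞ :=
  ∫⁻ x, (empiricalRademacher G x).toENNReal ∂(Measure.pi fun _ : Fin n => q)

end Rademacher

/-- The right-hand side of the estimation error bound. -/
def estimationErrorBound {X : Type u} [MeasurableSpace X] (L : ℝ) (ρ : Measure (X × ℤˣ))
    (G : Set (X → ℝ)) (nP nU : ℕ) (δ : ℝ) : ℝ :=
  8 * classPrior ρ * L * (rademacherComplexity nP (posMarginal ρ) G).toReal
    + 4 * L * (rademacherComplexity nU (marginal ρ) G).toReal
    + 2 * classPrior ρ * √(2 * Real.log (4 / δ) / nP)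
    + √(2 * Real.log (4 / δ) / nU)

/-- The setting of PU learning with the class `G` and sample sizes `nP`, `nU`: the data exist
(both samples are nonempty and `Y = +1` has positive probability), `G` satisfies the usual
measurability condition, and its two Rademacher complexities are finite. -/
structure IsPUSetting {X : Type u} [MeasurableSpace X] (ρ : Measure (X × ℤˣ))
    (G : Set (X → ℝ)) (nP nU : ℕ) : Prop where
  isProbabilityMeasure : IsProbabilityMeasure ρ
  classPrior_pos : 0 < classPrior ρ
  pos_sample : 0 < nP
  unl_sample : 0 < nU
  pointwiseMeasurable : IsPointwiseMeasurable G
  rademacher_pos_ne_top : rademacherComplexity nP (posMarginal ρ) G ≠ ⊤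
  rademacher_unl_ne_top : rademacherComplexity nU (marginal ρ) G ≠ ⊤

/-- With probability at least `q` under `μ`: the event `A` contains a measurable event of
probability at least `q`. -/
def HoldsWithProbAtLeast {Ω : Type u} [MeasurableSpace Ω] (μ : Measure Ω) (q : ℝ)
    (A : Ω → Prop) : Prop :=
  ∃ E : Set Ω, MeasurableSet E ∧ q ≤ μ.real E ∧ ∀ ω ∈ E, A ω

end PULearning

end

/-! Estimation error. Since `ℓ t (-1) = 1 - ℓ t 1`, the risk depends only on the mean of `ℓ (g x) 1`
under the positive law and of `ℓ (g x) (-1)` under the marginal law. The empirical PU risk replaces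
these means by sample averages, so the usual comparison of an empirical minimizer with `gstar`
reduces the claim to one-sided uniform deviation bounds, two per sample, each failing with
probability at most `δ / 4`.

Each bound combines McDiarmid's inequality, symmetrization by a ghost sample and the
Ledoux–Talagrand contraction principle. All three are proved for finite families, where suprema are
attained and measurable. Pointwise measurability carries the resulting bound to the whole class: a
countable subclass is exhausted by finite ones, and pointwise limits preserve the inequality.

Calibration. Write `η x` for the probability of the positive label at `x`. For every symmetric loss,
the risk is `K + ∫ (2 η x - 1) ℓ (g x) 1` with the same `K` and `η`, and this covers the zero-one
loss. Both conditional excess risks are therefore `|2 η x - 1|` times their value at `η = 1` or `η =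
0`. The calibration gaps at these two values alone give a linear comparison of the excess risks, and
`φ` is multiplication by a constant. -/

/-! ### Contraction for Rademacher averages -/

/-- Splitting off the first sign in a sum over sign vectors. -/
theorem sum_signs_succ {M : Type*} [AddCommMonoid M] {n : ℕ} (F : (Fin (n + 1) → ℤˣ) → M) :
    ∑ σ, F σ = ∑ s : ℤˣ, ∑ σ : Fin n → ℤˣ, F (Fin.cons s σ) := by
  rw [← Fintype.sum_prod_type', ← Equiv.sum_comp (Fin.consEquiv fun _ => ℤˣ)]
  rfl

theorem sum_sign {M : Type*} [AddCommMonoid M] (F : ℤˣ → M) : ∑ s, F s = F 1 + F (-1) := by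
  rw [show (Finset.univ : Finset ℤˣ) = {1, -1} from rfl,
    Finset.sum_insert (by decide), Finset.sum_singleton]

/-- The Ledoux–Talagrand contraction principle for a single sign. -/
theorem ciSup_add_ciSup_sub_le_of_lipschitz {K : Type*} [Finite K] [Nonempty K] {L : ℝ}
    (a w v : K → ℝ) (h : ∀ k l, |w k - w l| ≤ L * |v k - v l|) :
    (⨆ k, (a k + w k)) + (⨆ k, (a k - w k)) ≤ (⨆ k, (a k + L * v k)) + ⨆ k, (a k - L * v k) := by
  have hb (b : K → ℝ) : BddAbove (Set.range b) := (Set.finite_range b).bddAbove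
  obtain ⟨k, hk⟩ := exists_eq_ciSup_of_finite (f := fun k => a k + w k)
  obtain ⟨l, hl⟩ := exists_eq_ciSup_of_finite (f := fun k => a k - w k)
  rw [← hk, ← hl]
  have h₁ := le_ciSup (hb fun k => a k + L * v k)
  have h₂ := le_ciSup (hb fun k => a k - L * v k)
  have h₃ := (le_abs_self _).trans (h k l)
  have h₄ := h₁ k
  have h₅ := h₁ l
  have h₆ := h₂ k
  have h₇ := h₂ l
  -- If `v k ≥ v l`, the maximizers `k` and `l` are used in this order as candidates on the right;
  -- otherwise they are exchanged.
  rcases abs_cases (v k - v l) with ⟨e, _⟩ | ⟨e, _⟩ <;> rw [e] at h₃ <;> linarith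

/-- The Ledoux–Talagrand contraction principle for finite families. -/
theorem sum_signs_ciSup_comp_le {K : Type*} [Finite K] [Nonempty K] {L : ℝ} {ψ : ℝ → ℝ}
    (hψ : ∀ s t, |ψ s - ψ t| ≤ L * |s - t|) {n : ℕ} (b : K → ℝ) (v : K → Fin n → ℝ) :
    ∑ σ : Fin n → ℤˣ, ⨆ k, (b k + ∑ i, ((σ i : ℤ) : ℝ) * ψ (v k i)) ≤
      ∑ σ : Fin n → ℤˣ, ⨆ k, (b k + L * ∑ i, ((σ i : ℤ) : ℝ) * v k i) := by
  -- The offset is general so that it can hold the term of the first sign: the induction hypothesis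
  -- contracts the other coordinates with that sign fixed, and then the first coordinate is
  -- contracted with the others fixed.
  induction n generalizing b with
  | zero => simp
  | succ n ih =>
    simp only [sum_signs_succ, Fin.sum_univ_succ, Fin.cons_zero, Fin.cons_succ]
    calc _ ≤ ∑ s : ℤˣ, ∑ σ : Fin n → ℤˣ, ⨆ k, (b k + ((s : ℤ) : ℝ) * ψ (v k 0)
            + L * ∑ i, ((σ i : ℤ) : ℝ) * v k i.succ) := by
          refine Finset.sum_le_sum fun s _ => ?_
          simpa only [add_assoc] using
            ih (fun k => b k + ((s : ℤ) : ℝ) * ψ (v k 0)) fun k i => v k i.succ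
      _ ≤ _ := by
          rw [Finset.sum_comm, Finset.sum_comm (s := (Finset.univ : Finset ℤˣ))]
          refine Finset.sum_le_sum fun σ _ => ?_
          rw [sum_sign, sum_sign]
          convert ciSup_add_ciSup_sub_le_of_lipschitz
            (fun k => b k + L * ∑ i, ((σ i : ℤ) : ℝ) * v k i.succ) (fun k => ψ (v k 0))
            (fun k => v k 0) (fun k l => hψ _ _) using 4
          · rfl
          all_goals push_cast; ring

/-- The empirical Rademacher complexity of a finite family of vectors. -/
noncomputable def finiteRademacher {K : Type*} {n : ℕ} (v : K → Fin n → ℝ) : ℝ :=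
  ((2 : ℝ) ^ n)⁻¹ * ∑ σ : Fin n → ℤˣ, ⨆ k, (1 / n * ∑ i, ((σ i : ℤ) : ℝ) * v k i)

theorem finiteRademacher_comp_le {K : Type*} [Finite K] [Nonempty K] {L : ℝ} (hL : 0 ≤ L)
    {ψ : ℝ → ℝ} (hψ : ∀ s t, |ψ s - ψ t| ≤ L * |s - t|) {n : ℕ} (v : K → Fin n → ℝ) :
    finiteRademacher (fun k i => ψ (v k i)) ≤ L * finiteRademacher v := by
  have hn : (0 : ℝ) ≤ 1 / n := by positivity
  have h := sum_signs_ciSup_comp_le hψ 0 v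
  simp only [Pi.zero_apply, zero_add, ← Real.mul_iSup_of_nonneg hL, ← Finset.mul_sum] at h
  simp only [finiteRademacher, ← Real.mul_iSup_of_nonneg hn, ← Finset.mul_sum]
  calc _ ≤ ((2 : ℝ) ^ n)⁻¹ * (1 / n * (L * ∑ σ : Fin n → ℤˣ, ⨆ k, ∑ i, ((σ i : ℤ) : ℝ) * v k i)) := by
        gcongr
    _ = _ := by ring

theorem finiteRademacher_nonneg {K : Type*} [Finite K] [Nonempty K] {n : ℕ}
    (v : K → Fin n → ℝ) : 0 ≤ finiteRademacher v := by
  -- Contraction by the zero map: the left side vanishes.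
  simpa [finiteRademacher] using finiteRademacher_comp_le (ψ := fun _ => 0) zero_le_one
    (by simp) v

/-! ### McDiarmid's inequality -/

section BoundedDifferences

variable {X : Type*} [MeasurableSpace X]

theorem integrable_of_abs_le {μ : Measure X} [IsFiniteMeasure μ] {f : X → ℝ} (hf : Measurable f)
    {C : ℝ} (hC : ∀ x, |f x| ≤ C) : Integrable f μ :=
  .of_bound hf.aestronglyMeasurable C (ae_of_all _ hC)

theorem measurable_finCons {n : ℕ} :
    Measurable fun p : X × (Fin n → X) => (Fin.cons p.1 p.2 : Fin (n + 1) → X) := by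
  refine measurable_pi_iff.2 fun i => ?_
  cases i using Fin.cases with
  | zero => exact measurable_fst
  | succ j => exact (measurable_pi_apply j).comp measurable_snd

theorem integral_pi_finCons (q : Measure X) [IsProbabilityMeasure q] {n : ℕ}
    (h : (Fin (n + 1) → X) → ℝ) :
    ∫ x, h x ∂(Measure.pi fun _ => q) =
      ∫ p, h (Fin.cons p.1 p.2) ∂(q.prod (Measure.pi fun _ : Fin n => q)) := by
  rw [← (measurePreserving_piFinSuccAbove (fun _ : Fin (n + 1) => q) 0).symm.integral_comp']
  refine integral_congr_ae (ae_of_all _ fun p => ?_)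
  simp [MeasurableEquiv.piFinSuccAbove, Fin.insertNthEquiv, Fin.insertNth_zero']

theorem abs_exp_mul_sub_le {s a m C : ℝ} (ha : |a| ≤ C) :
    |Real.exp (s * (a - m))| ≤ Real.exp (|s| * (C + |m|)) := by
  rw [Real.abs_exp, Real.exp_le_exp]
  calc s * (a - m) ≤ |s| * |a - m| := (le_abs_self _).trans (abs_mul _ _).le
    _ ≤ _ := by gcongr; exact (abs_sub _ _).trans (by gcongr)

/-- The exponential moment bound behind McDiarmid's inequality. -/
theorem integral_exp_le_of_bounded_differences (q : Measure X) [IsProbabilityMeasure q] (c : ℝ)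
    {n : ℕ} {f : (Fin n → X) → ℝ} (hf : Measurable f) {C : ℝ} (hC : ∀ x, |f x| ≤ C)
    (hd : ∀ x i y, f (Function.update x i y) - f x ≤ c) (s : ℝ) :
    ∫ x, Real.exp (s * (f x - ∫ y, f y ∂(Measure.pi fun _ => q))) ∂(Measure.pi fun _ => q) ≤
      Real.exp (n * (c / 2) ^ 2 * s ^ 2 / 2) := by
  induction n with
  | zero =>
    rw [Measure.pi_of_empty (fun _ : Fin 0 => q) finZeroElim]
    simp
  | succ n ih =>
    have : Nonempty X := nonempty_of_isProbabilityMeasure q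
    set P : Measure (Fin n → X) := Measure.pi fun _ => q
    have hfc : Measurable fun p : X × (Fin n → X) => f (Fin.cons p.1 p.2) :=
      hf.comp measurable_finCons
    have hfa (a : X) : Measurable fun y : Fin n → X => f (Fin.cons a y) :=
      hfc.comp measurable_prodMk_left
    -- `F a` is the conditional mean given the first coordinate, the first step of the Doob
    -- martingale.
    set F : X → ℝ := fun a => ∫ y, f (Fin.cons a y) ∂P with hF
    have hFm : Measurable F := hfc.stronglyMeasurable.integral_prod_right'.measurable
    have hFC (a : X) : |F a| ≤ C := by
      have := norm_integral_le_of_norm_le_const (μ := P) (f := fun y => f (Fin.cons a y)) (C := C)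
        (ae_of_all _ fun y => hC _)
      simpa using this
    have hFd (a b : X) : F a - F b ≤ c := by
      rw [hF, ← integral_sub (integrable_of_abs_le (hfa a) fun y => hC _)
        (integrable_of_abs_le (hfa b) fun y => hC _)]
      calc _ ≤ ∫ _, c ∂P := by
            refine integral_mono ((integrable_of_abs_le (hfa a) fun y => hC _).sub
              (integrable_of_abs_le (hfa b) fun y => hC _)) (integrable_const _) fun y => ?_
            simpa [Fin.update_cons_zero] using hd (Fin.cons b y) 0 a
        _ = c := by simp
    have hm : ∫ x, f x ∂(Measure.pi fun _ => q) = ∫ a, F a ∂q := by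
      rw [integral_pi_finCons, integral_prod _ (integrable_of_abs_le hfc fun p => hC _)]
    set m := ∫ a, F a ∂q with hm_def
    have hFbdd : BddAbove (Set.range F) := ⟨C, by rintro _ ⟨a, rfl⟩; exact (abs_le.1 (hFC a)).2⟩
    -- The values of `F` lie in an interval of length `c` ending at its supremum, so Hoeffding's
    -- lemma gives the variance proxy `(c / 2) ^ 2`.
    have hoeffding : ∫ a, Real.exp (s * (F a - m)) ∂q ≤ Real.exp ((c / 2) ^ 2 * s ^ 2 / 2) := by
      have := (hasSubgaussianMGF_of_mem_Icc (μ := q) (X := F) (a := (⨆ a, F a) - c) (b := ⨆ a, F a)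
        hFm.aemeasurable (ae_of_all _ fun a => ⟨by
          have : (⨆ a, F a) ≤ F a + c := ciSup_le fun b => by linarith [hFd b a]
          linarith, le_ciSup hFbdd a⟩)).mgf_le s
      simpa [mgf, div_pow, sq_abs] using this
    have hint : Integrable (fun p : X × (Fin n → X) => Real.exp (s * (f (Fin.cons p.1 p.2) - m)))
        (q.prod P) :=
      integrable_of_abs_le (((hfc.sub_const m).const_mul s).exp)
        fun p => abs_exp_mul_sub_le (hC _)
    rw [hm, integral_pi_finCons, integral_prod _ hint]
    calc _ ≤ ∫ a, Real.exp (n * (c / 2) ^ 2 * s ^ 2 / 2) * Real.exp (s * (F a - m)) ∂q := by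
          refine integral_mono hint.integral_prod_left ((integrable_of_abs_le
            (((hFm.sub_const m).const_mul s).exp)
              fun a => abs_exp_mul_sub_le (hFC a)).const_mul _) fun a => ?_
          -- For fixed `a`, the fluctuation around `F a` involves only `n` coordinates; the
          -- remaining factor depends on `a` alone.
          have key := ih (hfa a) (fun y => hC _) fun y i b => by
            simpa [Fin.cons_update] using hd (Fin.cons a y) i.succ b
          have hsplit (y : Fin n → X) : Real.exp (s * (f (Fin.cons a y) - m)) =
              Real.exp (s * (f (Fin.cons a y) - F a)) * Real.exp (s * (F a - m)) := by
            rw [← Real.exp_add]; ring_nf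
          simp only [hsplit, integral_mul_const]
          gcongr
      _ ≤ Real.exp (n * (c / 2) ^ 2 * s ^ 2 / 2) * Real.exp ((c / 2) ^ 2 * s ^ 2 / 2) := by
          rw [integral_const_mul]; gcongr
      _ = _ := by rw [← Real.exp_add]; push_cast; ring_nf

/-- **McDiarmid's inequality** for identically distributed coordinates. -/
theorem measureReal_ge_le_of_bounded_differences (q : Measure X) [IsProbabilityMeasure q] (c : ℝ≥0)
    {n : ℕ} {f : (Fin n → X) → ℝ} (hf : Measurable f) {C : ℝ} (hC : ∀ x, |f x| ≤ C)
    (hd : ∀ x i y, f (Function.update x i y) - f x ≤ c) {ε : ℝ} (hε : 0 ≤ ε) :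
    (Measure.pi fun _ => q).real {x | ε ≤ f x - ∫ y, f y ∂(Measure.pi fun _ => q)} ≤
      Real.exp (-ε ^ 2 / (2 * (n * (c / 2) ^ 2))) := by
  have h : HasSubgaussianMGF (fun x => f x - ∫ y, f y ∂(Measure.pi fun _ => q))
      (n * (c / 2) ^ 2) (Measure.pi fun _ => q) :=
    { integrable_exp_mul := fun t => integrable_of_abs_le (((hf.sub_const _).const_mul t).exp)
        fun x => abs_exp_mul_sub_le (hC x)
      mgf_le := fun t => by
        simpa [mgf] using integral_exp_le_of_bounded_differences q c hf hC hd t }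
  simpa using h.measure_ge_le hε

end BoundedDifferences

/-! ### Symmetrization with a ghost sample -/

section Symmetrization

theorem abs_ciSup_le_of_forall {K : Type*} [Nonempty K] {w : K → ℝ} {C : ℝ}
    (h : ∀ k, |w k| ≤ C) : |⨆ k, w k| ≤ C := by
  refine abs_le.2 ⟨?_, ciSup_le fun k => (abs_le.1 (h k)).2⟩
  obtain ⟨k⟩ := ‹Nonempty K›
  exact (abs_le.1 (h k)).1.trans
    (le_ciSup ⟨C, by rintro _ ⟨l, rfl⟩; exact (abs_le.1 (h l)).2⟩ k)

theorem abs_average_le {n : ℕ} {w : Fin n → ℝ} {C : ℝ} (hC : 0 ≤ C) (h : ∀ i, |w i| ≤ C) :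
    |1 / (n : ℝ) * ∑ i, w i| ≤ C := by
  have h₁ : |∑ i, w i| ≤ n * C := by
    simpa using (Finset.abs_sum_le_sum_abs w Finset.univ).trans
      (Finset.sum_le_sum fun i _ => h i)
  rw [abs_mul, abs_of_nonneg (by positivity : (0 : ℝ) ≤ 1 / n), one_div_mul_eq_div]
  exact div_le_of_le_mul₀ (by positivity) hC (by linarith)

theorem abs_sign (s : ℤˣ) : |((s : ℤ) : ℝ)| = 1 := by
  rcases Int.units_eq_one_or s with rfl | rfl <;> simp

variable {X : Type*} [MeasurableSpace X]

/-- Exchanging the coordinates `x i` and `y i` for `σ i = -1`. -/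
def swapBySigns {n : ℕ} (σ : Fin n → ℤˣ) (p : (Fin n → X) × (Fin n → X)) :
    (Fin n → X) × (Fin n → X) :=
  (fun i => if σ i = 1 then p.1 i else p.2 i, fun i => if σ i = 1 then p.2 i else p.1 i)

/-- The law is a product of `n` copies of `q.prod q`, each invariant under exchange of its two
coordinates. -/
theorem measurePreserving_swapBySigns (q : Measure X) [IsProbabilityMeasure q] {n : ℕ}
    (σ : Fin n → ℤˣ) :
    MeasurePreserving (swapBySigns σ)
      ((Measure.pi fun _ : Fin n => q).prod (Measure.pi fun _ : Fin n => q))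
      ((Measure.pi fun _ : Fin n => q).prod (Measure.pi fun _ : Fin n => q)) := by
  have he := measurePreserving_arrowProdEquivProdArrow X X (Fin n) (fun _ => q) (fun _ => q)
  have hs := measurePreserving_pi (fun _ : Fin n => q.prod q) (fun _ : Fin n => q.prod q)
    (f := fun i => if σ i = 1 then id else Prod.swap) fun i => by
      split_ifs
      · exact MeasurePreserving.id _
      · exact Measure.measurePreserving_swap
  convert he.comp (hs.comp he.symm) using 1
  ext p i
  · by_cases h : σ i = 1 <;>
      simp [swapBySigns, h, MeasurableEquiv.arrowProdEquivProdArrow, Equiv.arrowProdEquivProdArrow]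
  · by_cases h : σ i = 1 <;>
      simp [swapBySigns, h, MeasurableEquiv.arrowProdEquivProdArrow, Equiv.arrowProdEquivProdArrow]

theorem MeasureTheory.MeasurePreserving.integral_comp_of_measurable {α β : Type*}
    [MeasurableSpace α] [MeasurableSpace β] {μ : Measure α} {ν : Measure β} {T : α → β}
    (hT : MeasurePreserving T μ ν) {f : β → ℝ} (hf : Measurable f) :
    ∫ a, f (T a) ∂μ = ∫ b, f b ∂ν := by
  rw [← hT.map_eq, integral_map hT.measurable.aemeasurable hf.aestronglyMeasurable]

theorem measurable_ciSup_average {K : Type*} [Finite K] {Ω : Type*} [MeasurableSpace Ω] {n : ℕ}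
    {w : K → Fin n → Ω → ℝ} (hw : ∀ k i, Measurable (w k i)) :
    Measurable fun ω => ⨆ k, (1 / (n : ℝ) * ∑ i, w k i ω) :=
  Measurable.iSup fun k => (Finset.measurable_sum _ fun i _ => hw k i).const_mul _

/-- Symmetrization for a finite family of functions with values in `[-1, 1]`. -/
theorem integral_ciSup_deviation_le {K : Type*} [Finite K] [Nonempty K] (q : Measure X)
    [IsProbabilityMeasure q] {n : ℕ} (hn : 0 < n) {h : K → X → ℝ} (hm : ∀ k, Measurable (h k))
    (hb : ∀ k x, |h k x| ≤ 1) :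
    ∫ x, (⨆ k, (∫ z, h k z ∂q - 1 / n * ∑ i, h k (x i))) ∂(Measure.pi fun _ : Fin n => q) ≤
      2 * ∫ x, finiteRademacher (fun k i => h k (x i)) ∂(Measure.pi fun _ : Fin n => q) := by
  set P : Measure (Fin n → X) := Measure.pi fun _ => q
  have hbdd (b : K → ℝ) : BddAbove (Set.range b) := (Set.finite_range b).bddAbove
  have hme (k : K) (i : Fin n) : Measurable fun x : Fin n → X => h k (x i) :=
    (hm k).comp (measurable_pi_apply i)
  set A : (Fin n → ℤˣ) → (Fin n → X) → ℝ := fun σ x =>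
    ⨆ k, (1 / n * ∑ i, ((σ i : ℤ) : ℝ) * h k (x i)) with hA
  set D : (Fin n → ℤˣ) → (Fin n → X) × (Fin n → X) → ℝ := fun σ p =>
    ⨆ k, (1 / n * ∑ i, ((σ i : ℤ) : ℝ) * (h k (p.2 i) - h k (p.1 i))) with hD
  have hAm (σ) : Measurable (A σ) := measurable_ciSup_average fun k i => (hme k i).const_mul _
  have hDm (σ) : Measurable (D σ) := measurable_ciSup_average fun k i =>
    (((hme k i).comp measurable_snd).sub ((hme k i).comp measurable_fst)).const_mul _
  have hAi (σ) : Integrable (A σ) P := integrable_of_abs_le (hAm σ) fun x =>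
    abs_ciSup_le_of_forall fun k => abs_average_le zero_le_one fun i => by
      rw [abs_mul, abs_sign, one_mul]; exact hb _ _
  have hDi (σ) : Integrable (D σ) (P.prod P) := integrable_of_abs_le (C := 2) (hDm σ) fun x =>
    abs_ciSup_le_of_forall fun k => abs_average_le zero_le_two fun i => by
      rw [abs_mul, abs_sign, one_mul]
      exact (abs_sub _ _).trans (by linarith [hb k (x.1 i), hb k (x.2 i)])
  -- A sign `-1` in front of a difference amounts to exchanging the two sample points.
  have hswap (σ) : ∫ p, D σ p ∂(P.prod P) = ∫ p, D 1 p ∂(P.prod P) := by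
    rw [← (measurePreserving_swapBySigns q σ).integral_comp_of_measurable (hDm 1)]
    refine integral_congr_ae (ae_of_all _ fun p => ?_)
    simp only [hD]
    congr! 4 with k i
    rcases Int.units_eq_one_or (σ i) with e | e <;> simp [swapBySigns, e]
  -- The mean is the expected average over an independent sample, and a supremum of integrals is at
  -- most the integral of the supremum.
  have hghost : ∫ x, (⨆ k, (∫ z, h k z ∂q - 1 / n * ∑ i, h k (x i))) ∂P ≤
      ∫ p, D 1 p ∂(P.prod P) := by
    rw [integral_prod _ (hDi 1)]
    refine integral_mono (integrable_of_abs_le (C := 2) (Measurable.iSup fun k =>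
      ((Finset.measurable_sum _ fun i _ => hme k i).const_mul _).const_sub _) fun x =>
        abs_ciSup_le_of_forall fun k => ?_) (hDi 1).integral_prod_left fun x => ciSup_le fun k => ?_
    · have h₁ : |∫ z, h k z ∂q| ≤ 1 := by
        simpa using norm_integral_le_of_norm_le_const (μ := q) (f := h k) (C := 1) (ae_of_all _ (hb k))
      have h₂ := abs_average_le zero_le_one fun i => hb k (x i)
      exact (abs_sub _ _).trans (by linarith)
    · have hki (i : Fin n) : Integrable (fun y : Fin n → X => h k (y i)) P :=
        integrable_of_abs_le (hme k i) fun y => hb k _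
      have hint : ∫ z, h k z ∂q - 1 / n * ∑ i, h k (x i) =
          ∫ y, 1 / n * ∑ i, (h k (y i) - h k (x i)) ∂P := by
        rw [integral_const_mul,
          integral_finsetSum (f := fun i (y : Fin n → X) => h k (y i) - h k (x i)) _ fun i _ => (hki i).sub (integrable_const _)]
        have hi (i : Fin n) : ∫ y, (h k (y i) - h k (x i)) ∂P = ∫ z, h k z ∂q - h k (x i) := by
          rw [integral_sub (hki i) (integrable_const _),
            (measurePreserving_eval (fun _ : Fin n => q) i).integral_comp_of_measurable (hm k)]
          simp
        simp only [hi, Finset.sum_sub_distrib, Finset.sum_const, Finset.card_univ,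
          Fintype.card_fin, nsmul_eq_mul]
        have : (n : ℝ) ≠ 0 := by positivity
        field_simp
      rw [hint]
      refine integral_mono ((integrable_finsetSum _ fun i _ =>
        (hki i).sub (integrable_const _)).const_mul _) ?_ fun y => ?_
      · exact integrable_of_abs_le (C := 2) ((hDm 1).comp measurable_prodMk_left) fun y =>
          abs_ciSup_le_of_forall fun k => abs_average_le zero_le_two fun i => by
            rw [abs_mul, abs_sign, one_mul]
            exact (abs_sub _ _).trans (by linarith [hb k (x i), hb k (y i)])
      · refine le_of_eq_of_le ?_ (le_ciSup (hbdd _) k)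
        simp
  -- The supremum of a sum is split between the two samples; the minus sign of the first sample
  -- turns `σ` into `-σ`, which is harmless after summing over all sign vectors.
  have hsplit (σ) : ∫ p, D σ p ∂(P.prod P) ≤ ∫ x, A σ x ∂P + ∫ x, A (-σ) x ∂P := by
    have h₁ := (measurePreserving_snd (μ := P) (ν := P)).integral_comp_of_measurable (hAm σ)
    have h₂ := (measurePreserving_fst (μ := P) (ν := P)).integral_comp_of_measurable (hAm (-σ))
    have i₁ : Integrable (fun p : (Fin n → X) × (Fin n → X) => A σ p.2) (P.prod P) :=
      (hAi σ).comp_snd P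
    have i₂ : Integrable (fun p : (Fin n → X) × (Fin n → X) => A (-σ) p.1) (P.prod P) :=
      (hAi (-σ)).comp_fst P
    rw [← h₁, ← h₂, ← integral_add i₁ i₂]
    refine integral_mono (hDi σ) (i₁.add i₂) fun p => ciSup_le fun k => ?_
    refine le_of_eq_of_le ?_ (add_le_add (le_ciSup (hbdd _) k) (le_ciSup (hbdd _) k))
    rw [← mul_add, ← Finset.sum_add_distrib]
    congr! 2 with i
    simp only [Pi.neg_apply, Units.val_neg, Int.cast_neg]
    ring
  have hsum : (2 : ℝ) ^ n * ∫ p, D 1 p ∂(P.prod P) ≤ 2 * ∑ σ, ∫ x, A σ x ∂P := by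
    calc (2 : ℝ) ^ n * ∫ p, D 1 p ∂(P.prod P) = ∑ σ, ∫ p, D σ p ∂(P.prod P) := by
          simp [hswap]
      _ ≤ ∑ σ, (∫ x, A σ x ∂P + ∫ x, A (-σ) x ∂P) := Finset.sum_le_sum fun σ _ => hsplit σ
      _ = _ := by
          have := Equiv.sum_comp (Equiv.neg (Fin n → ℤˣ)) fun σ => ∫ x, A σ x ∂P
          simp only [Equiv.neg_apply] at this
          rw [Finset.sum_add_distrib, this, two_mul]
  have hrad : ∫ x, finiteRademacher (fun k i => h k (x i)) ∂P =
      ((2 : ℝ) ^ n)⁻¹ * ∑ σ, ∫ x, A σ x ∂P := by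
    rw [← integral_finsetSum _ fun σ _ => hAi σ, ← integral_const_mul]
    rfl
  rw [hrad]
  refine hghost.trans ?_
  rw [← mul_assoc, mul_comm 2, mul_assoc, ← div_eq_inv_mul, le_div_iff₀ (by positivity)]
  linarith

end Symmetrization

/-! ### Uniform deviation bounds -/

section UniformDeviation

open PULearning

variable {X : Type u}

/-- The only link needed between finite subfamilies and the extended-valued complexity of `G`:
monotonicity of the lower integral then avoids measurability of the supremum over `G`. -/
theorem ofReal_finiteRademacher_le {K : Type*} [Finite K] [Nonempty K] {G : Set (X → ℝ)}
    {u : K → X → ℝ} (hu : ∀ k, u k ∈ G) {n : ℕ} (x : Fin n → X) :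
    ENNReal.ofReal (finiteRademacher fun k i => u k (x i)) ≤
      (empiricalRademacher G x).toENNReal := by
  rw [← EReal.real_coe_toENNReal]
  refine EReal.toENNReal_le_toENNReal ?_
  rw [finiteRademacher, EReal.coe_mul]
  refine mul_le_mul_of_nonneg_left ?_
    (by exact_mod_cast (by positivity : (0 : ℝ) ≤ ((2 : ℝ) ^ n)⁻¹))
  rw [show ((∑ σ : Fin n → ℤˣ, ⨆ k, (1 / n * ∑ i, ((σ i : ℤ) : ℝ) * u k (x i)) : ℝ) : EReal) =
    ∑ σ : Fin n → ℤˣ, ((⨆ k, (1 / n * ∑ i, ((σ i : ℤ) : ℝ) * u k (x i)) : ℝ) : EReal) from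
      map_sum (⟨⟨Real.toEReal, rfl⟩, EReal.coe_add⟩ : ℝ →+ EReal) _ _]
  refine Finset.sum_le_sum fun σ _ => ?_
  obtain ⟨k, hk⟩ := exists_eq_ciSup_of_finite
    (f := fun k => (1 / n * ∑ i, ((σ i : ℤ) : ℝ) * u k (x i) : ℝ))
  rw [← hk]
  exact le_iSup₂_of_le (u k) (hu k) le_rfl

variable [MeasurableSpace X]

theorem measurable_finiteRademacher {K : Type*} [Finite K] {u : K → X → ℝ}
    (hm : ∀ k, Measurable (u k)) {n : ℕ} :
    Measurable fun x : Fin n → X => finiteRademacher fun k i => u k (x i) :=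
  (Finset.measurable_sum _ fun _ _ => measurable_ciSup_average fun k i =>
    ((hm k).comp (measurable_pi_apply i)).const_mul _).const_mul _

theorem lintegral_finiteRademacher_le {K : Type*} [Finite K] [Nonempty K] {G : Set (X → ℝ)}
    {u : K → X → ℝ} (hu : ∀ k, u k ∈ G) (q : Measure X) (n : ℕ) :
    ∫⁻ x, ENNReal.ofReal (finiteRademacher fun k i => u k (x i)) ∂(Measure.pi fun _ : Fin n => q) ≤
      rademacherComplexity n q G :=
  lintegral_mono fun x => ofReal_finiteRademacher_le hu x

theorem integrable_finiteRademacher {K : Type*} [Finite K] [Nonempty K] {G : Set (X → ℝ)}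
    {u : K → X → ℝ} (hu : ∀ k, u k ∈ G) (hm : ∀ k, Measurable (u k)) {q : Measure X} {n : ℕ}
    (hG : rademacherComplexity n q G ≠ ⊤) :
    Integrable (fun x : Fin n → X => finiteRademacher fun k i => u k (x i))
      (Measure.pi fun _ => q) := by
  refine ⟨(measurable_finiteRademacher hm).aestronglyMeasurable, ?_⟩
  rw [hasFiniteIntegral_iff_ofReal (ae_of_all _ fun x => finiteRademacher_nonneg _)]
  exact (lintegral_finiteRademacher_le hu q n).trans_lt hG.lt_top

theorem integral_finiteRademacher_le {K : Type*} [Finite K] [Nonempty K] {G : Set (X → ℝ)}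
    {u : K → X → ℝ} (hu : ∀ k, u k ∈ G) (hm : ∀ k, Measurable (u k)) {q : Measure X} {n : ℕ}
    (hG : rademacherComplexity n q G ≠ ⊤) :
    ∫ x, finiteRademacher (fun k i => u k (x i)) ∂(Measure.pi fun _ : Fin n => q) ≤
      (rademacherComplexity n q G).toReal := by
  rw [integral_eq_lintegral_of_nonneg_ae (ae_of_all _ fun x => finiteRademacher_nonneg _)
    (measurable_finiteRademacher hm).aestronglyMeasurable]
  exact ENNReal.toReal_mono hG (lintegral_finiteRademacher_le hu q n)

variable (q : Measure X) {n : ℕ} {L : ℝ≥0} {ψ : ℝ → ℝ}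

/-- The amount by which the mean of `ψ ∘ g` exceeds its average over the sample `x`. -/
noncomputable def deviation (ψ : ℝ → ℝ) (g : X → ℝ) (x : Fin n → X) : ℝ :=
  ∫ z, ψ (g z) ∂q - 1 / n * ∑ i, ψ (g (x i))

theorem deviation_update_le (hn : 0 < n) (hψ : ∀ t, ψ t ∈ Set.Icc (0 : ℝ) 1) (g : X → ℝ)
    (x : Fin n → X) (i : Fin n) (y : X) :
    deviation q ψ g (Function.update x i y) ≤ deviation q ψ g x + 1 / n := by
  have h : ∑ j, (ψ (g (x j)) - ψ (g (Function.update x i y j))) = ψ (g (x i)) - ψ (g y) := by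
    rw [Fintype.sum_eq_single i fun j hj => by simp [hj]]
    simp
  rw [Finset.sum_sub_distrib] at h
  have hn' : (0 : ℝ) < 1 / n := by positivity
  simp only [deviation]
  nlinarith [(hψ (g (x i))).2, (hψ (g y)).1]

theorem measurable_deviation (hψ : Measurable ψ) {g : X → ℝ} (hg : Measurable g) :
    Measurable (deviation q ψ g : (Fin n → X) → ℝ) :=
  ((Finset.measurable_sum _ fun i _ =>
    hψ.comp (hg.comp (measurable_pi_apply i))).const_mul _).const_sub _

theorem abs_deviation_le [IsProbabilityMeasure q]
    (hψ : ∀ t, ψ t ∈ Set.Icc (0 : ℝ) 1) (g : X → ℝ) (x : Fin n → X) :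
    |deviation q ψ g x| ≤ 2 := by
  have hb (t : ℝ) : |ψ t| ≤ 1 := abs_le.2 ⟨by linarith [(hψ t).1], (hψ t).2⟩
  have h₁ : |∫ z, ψ (g z) ∂q| ≤ 1 := by
    simpa using norm_integral_le_of_norm_le_const (μ := q) (f := fun z => ψ (g z)) (C := 1)
      (ae_of_all _ fun z => hb _)
  have h₂ := abs_average_le zero_le_one fun i => hb (g (x i))
  exact (abs_sub _ _).trans (by linarith)

/-- The uniform deviation bound for a finite family. -/
theorem finite_uniform_deviation [IsProbabilityMeasure q]
    {K : Type*} [Finite K] [Nonempty K] {G : Set (X → ℝ)}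
    {u : K → X → ℝ} (hu : ∀ k, u k ∈ G) (hm : ∀ k, Measurable (u k)) (hn : 0 < n)
    (hψ : ∀ t, ψ t ∈ Set.Icc (0 : ℝ) 1) (hL : LipschitzWith L ψ)
    (hG : rademacherComplexity n q G ≠ ⊤) {ε : ℝ} (hε : 0 ≤ ε) :
    1 - Real.exp (-2 * n * ε ^ 2) ≤ (Measure.pi fun _ => q).real {x : Fin n → X |
      ∀ k, deviation q ψ (u k) x ≤ 2 * L * (rademacherComplexity n q G).toReal + ε} := by
  set P : Measure (Fin n → X) := Measure.pi fun _ => q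
  set Φ : (Fin n → X) → ℝ := fun x => ⨆ k, deviation q ψ (u k) x with hΦ
  have hbdd (b : K → ℝ) : BddAbove (Set.range b) := (Set.finite_range b).bddAbove
  have hψm : Measurable ψ := hL.continuous.measurable
  have hLip (s t : ℝ) : |ψ s - ψ t| ≤ L * |s - t| := by
    simpa [Real.dist_eq] using hL.dist_le_mul s t
  have hdm (k : K) : Measurable (deviation q ψ (u k) : (Fin n → X) → ℝ) :=
    measurable_deviation q hψm (hm k)
  have hΦm : Measurable Φ := Measurable.iSup hdm
  have hmean : ∫ x, Φ x ∂P ≤ 2 * L * (rademacherComplexity n q G).toReal := by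
    calc ∫ x, Φ x ∂P ≤ 2 * ∫ x, finiteRademacher (fun k i => ψ (u k (x i))) ∂P :=
          integral_ciSup_deviation_le q hn (h := fun k z => ψ (u k z))
            (fun k => hψm.comp (hm k)) fun k x =>
              abs_le.2 ⟨by linarith [(hψ (u k x)).1], (hψ _).2⟩
      _ ≤ 2 * ∫ x, L * finiteRademacher (fun k i => u k (x i)) ∂P := by
          gcongr 2 * ?_
          refine integral_mono_of_nonneg (ae_of_all _ fun x => finiteRademacher_nonneg _)
            ((integrable_finiteRademacher hu hm hG).const_mul _)
            (ae_of_all _ fun x => finiteRademacher_comp_le L.2 hLip _)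
      _ ≤ _ := by
          rw [integral_const_mul, ← mul_assoc]
          gcongr
          exact integral_finiteRademacher_le hu hm hG
  -- Replacing one sample point changes an average of values in `[0, 1]` by at most `1 / n`; this
  -- gives the exponent `-2 n ε²`.
  have hmc := measureReal_ge_le_of_bounded_differences q (1 / n : ℝ≥0) hΦm (C := 2)
    (fun x => abs_ciSup_le_of_forall fun k => abs_deviation_le q hψ _ x)
    (fun x i y => by
      rw [sub_le_iff_le_add']
      refine ciSup_le fun k => (deviation_update_le q hn hψ (u k) x i y).trans ?_
      push_cast
      gcongr
      exact le_ciSup (hbdd fun k => deviation q ψ (u k) x) k) hε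
  have hexp : -ε ^ 2 / (2 * (n * (((1 / n : ℝ≥0) : ℝ) / 2) ^ 2)) = -2 * n * ε ^ 2 := by
    have : (n : ℝ) ≠ 0 := by positivity
    push_cast
    field_simp
  rw [hexp] at hmc
  have hmeas : MeasurableSet {x : Fin n → X |
      ∀ k, deviation q ψ (u k) x ≤ 2 * L * (rademacherComplexity n q G).toReal + ε} := by
    rw [Set.ofPred_forall]
    exact MeasurableSet.iInter fun k => measurableSet_le (hdm k) measurable_const
  have hc := probReal_compl_eq_one_sub (μ := P) hmeas
  have hle : P.real {x : Fin n → X | ∀ k, deviation q ψ (u k) x ≤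
      2 * L * (rademacherComplexity n q G).toReal + ε}ᶜ ≤ P.real {x | ε ≤ Φ x - ∫ y, Φ y ∂P} := by
    refine measureReal_mono fun x hx => ?_
    simp only [Set.mem_compl_iff, Set.mem_ofPred_eq, not_forall, not_le] at hx ⊢
    obtain ⟨k, hk⟩ := hx
    linarith [le_ciSup (hbdd fun k => deviation q ψ (u k) x) k]
  linarith

/-- The uniform deviation bound for a pointwise measurable class. -/
theorem uniform_deviation [IsProbabilityMeasure q] {G : Set (X → ℝ)}
    (hG₀ : IsPointwiseMeasurable G) (hne : G.Nonempty)
    (hn : 0 < n) (hψ : ∀ t, ψ t ∈ Set.Icc (0 : ℝ) 1) (hL : LipschitzWith L ψ)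
    (hG : rademacherComplexity n q G ≠ ⊤) {ε : ℝ} (hε : 0 ≤ ε) :
    ∃ E : Set (Fin n → X), MeasurableSet E ∧
      1 - Real.exp (-2 * n * ε ^ 2) ≤ (Measure.pi fun _ => q).real E ∧
      ∀ x ∈ E, ∀ g ∈ G,
        deviation q ψ g x ≤ 2 * L * (rademacherComplexity n q G).toReal + ε := by
  obtain ⟨hm, G₀, hsub, hcount, happrox⟩ := hG₀
  have hne₀ : G₀.Nonempty := by
    obtain ⟨g, hg⟩ := hne
    obtain ⟨v, hv, -⟩ := happrox g hg
    exact ⟨v 0, hv 0⟩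
  obtain ⟨e, rfl⟩ := hcount.exists_eq_range hne₀
  have he (k : ℕ) : e k ∈ G := hsub ⟨k, rfl⟩
  have hψm : Measurable ψ := hL.continuous.measurable
  set b := 2 * L * (rademacherComplexity n q G).toReal + ε
  set A : ℕ → Set (Fin n → X) := fun N => {x | ∀ k : Fin (N + 1), deviation q ψ (e k) x ≤ b}
  have hA (N : ℕ) : MeasurableSet (A N) := by
    simp only [A, Set.ofPred_forall]
    exact MeasurableSet.iInter fun k =>
      measurableSet_le (measurable_deviation q hψm (hm _ (he k))) measurable_const
  have hanti : Antitone A := fun M N hMN x hx k =>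
    hx ⟨k, k.2.trans_le (Nat.add_le_add_right hMN 1)⟩
  refine ⟨⋂ N, A N, MeasurableSet.iInter hA, ?_, fun x hx g hg => ?_⟩
  -- Continuity from above: the finite bound is uniform in the size of the family.
  · refine ge_of_tendsto ((ENNReal.tendsto_toReal (measure_ne_top _ _)).comp
      (tendsto_measure_iInter_atTop (fun N => (hA N).nullMeasurableSet) hanti
        ⟨0, measure_ne_top _ _⟩)) (Eventually.of_forall fun N => ?_)
    exact finite_uniform_deviation q (u := fun k : Fin (N + 1) => e k) (fun k => he k)
      (fun k => hm _ (he k)) hn hψ hL hG hε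
  · obtain ⟨v, hv, hlim⟩ := happrox g hg
    -- The deviation is continuous under pointwise limits, by dominated convergence for the mean and
    -- termwise for the average.
    have hint : Tendsto (fun j => ∫ z, ψ (v j z) ∂q) atTop (𝓝 (∫ z, ψ (g z) ∂q)) :=
      tendsto_integral_of_dominated_convergence (fun _ => 1)
        (fun j => (hψm.comp (hm _ (hsub (hv j)))).aestronglyMeasurable) (integrable_const _)
        (fun j => ae_of_all _ fun z => by
          rw [Real.norm_eq_abs]
          exact abs_le.2 ⟨by linarith [(hψ (v j z)).1], (hψ _).2⟩)
        (ae_of_all _ fun z => (hL.continuous.tendsto _).comp (hlim z))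
    have hdev : Tendsto (fun j => deviation q ψ (v j) x) atTop (𝓝 (deviation q ψ g x)) :=
      hint.sub ((tendsto_finsetSum _ fun i _ =>
        (hL.continuous.tendsto _).comp (hlim (x i))).const_mul _)
    refine le_of_tendsto' hdev fun j => ?_
    obtain ⟨k, hk⟩ := hv j
    rw [← hk]
    exact Set.mem_iInter.1 hx k ⟨k, Nat.lt_succ_self k⟩

end UniformDeviation

/-! ### The PU form of the risk -/

section Risk

open PULearning

variable {X : Type u} [MeasurableSpace X] {ρ : Measure (X × ℤˣ)} {ℓ : ℝ → ℤˣ → ℝ}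

theorem measurableSet_positive : MeasurableSet {z : X × ℤˣ | z.2 = 1} := by
  have : MeasurableSet {y : ℤˣ | y = 1} :=
    ⟨{1}, measurableSet_singleton _, by ext y; simp⟩
  exact measurable_snd this

theorem setIntegral_positive (h : 0 < classPrior ρ) {F : X → ℝ} (hF : Measurable F) :
    ∫ z in {z | z.2 = 1}, F z.1 ∂ρ = classPrior ρ * ∫ x, F x ∂(posMarginal ρ) := by
  rw [posMarginal, integral_map measurable_fst.aemeasurable hF.aestronglyMeasurable,
    ProbabilityTheory.cond, integral_smul_measure, ENNReal.toReal_inv, smul_eq_mul,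
    ← mul_assoc]
  change _ = classPrior ρ * (classPrior ρ)⁻¹ * _
  rw [mul_inv_cancel₀ h.ne', one_mul]

variable [IsProbabilityMeasure ρ]

instance : IsProbabilityMeasure (marginal ρ) :=
  Measure.isProbabilityMeasure_map measurable_fst.aemeasurable

theorem isProbabilityMeasure_posMarginal (h : 0 < classPrior ρ) :
    IsProbabilityMeasure (posMarginal ρ) := by
  have : ρ {z | z.2 = 1} ≠ 0 := fun h₀ => h.ne' (by simp [classPrior, measureReal_def, h₀])
  have := cond_isProbabilityMeasure this
  exact Measure.isProbabilityMeasure_map measurable_fst.aemeasurable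

theorem abs_le_one_of_mem_Icc {t : ℝ} (h : t ∈ Set.Icc (0 : ℝ) 1) : |t| ≤ 1 :=
  abs_le.2 ⟨by linarith [h.1], h.2⟩

/-- The risk of a symmetric loss in terms of the marginal law and of the positive part of `ρ`. -/
theorem risk_eq_integral_add_setIntegral (hsym : ∀ t, ℓ t 1 + ℓ t (-1) = 1)
    (hrange : ∀ t y, ℓ t y ∈ Set.Icc (0 : ℝ) 1) (hm : ∀ y, Measurable fun t => ℓ t y)
    {g : X → ℝ} (hg : Measurable g) :
    risk ℓ ρ g = ∫ x, ℓ (g x) (-1) ∂(marginal ρ)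
      + ∫ z in {z | z.2 = 1}, (2 * ℓ (g z.1) 1 - 1) ∂ρ := by
  have hmg (y : ℤˣ) : Measurable fun x => ℓ (g x) y := (hm y).comp hg
  have hi (y : ℤˣ) : Integrable (fun z : X × ℤˣ => ℓ (g z.1) y) ρ :=
    integrable_of_abs_le ((hmg y).comp measurable_fst)
      fun z => abs_le_one_of_mem_Icc (hrange _ _)
  have hi₁ : Integrable (fun z : X × ℤˣ => 2 * ℓ (g z.1) 1 - 1) ρ :=
    ((hi 1).const_mul 2).sub (integrable_const 1)
  rw [marginal, integral_map measurable_fst.aemeasurable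
    (hmg _).aestronglyMeasurable, ← integral_indicator measurableSet_positive,
    ← integral_add (hi _) (hi₁.indicator measurableSet_positive)]
  -- On the positive part, symmetry gives `ℓ t 1 = ℓ t (-1) + (2 * ℓ t 1 - 1)`; elsewhere the
  -- indicator vanishes.
  refine integral_congr_ae (ae_of_all _ fun z => ?_)
  have := hsym (g z.1)
  rcases Int.units_eq_one_or z.2 with h | h
  · simp only [h, Set.indicator, Set.mem_ofPred_eq, if_true]
    linarith
  · simp [h, Set.indicator]

theorem risk_eq (hsym : ∀ t, ℓ t 1 + ℓ t (-1) = 1)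
    (hrange : ∀ t y, ℓ t y ∈ Set.Icc (0 : ℝ) 1) (hm : ∀ y, Measurable fun t => ℓ t y)
    (h : 0 < classPrior ρ) {g : X → ℝ} (hg : Measurable g) :
    risk ℓ ρ g = -classPrior ρ + 2 * classPrior ρ * ∫ x, ℓ (g x) 1 ∂(posMarginal ρ)
      + ∫ x, ℓ (g x) (-1) ∂(marginal ρ) := by
  have := isProbabilityMeasure_posMarginal h
  have hmg : Measurable fun x => ℓ (g x) 1 := (hm 1).comp hg
  rw [risk_eq_integral_add_setIntegral hsym hrange hm hg,
    setIntegral_positive h (F := fun x => 2 * ℓ (g x) 1 - 1)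
      ((hmg.const_mul 2).sub_const 1),
    integral_sub ((integrable_of_abs_le hmg
      fun x => abs_le_one_of_mem_Icc (hrange _ _)).const_mul 2) (integrable_const 1),
    integral_const_mul]
  simp
  ring

/-- Makes one-sided bounds for both labels control both tails. For `gstar` the empirical average
must not exceed the mean by much, which is an upper deviation for the opposite label. -/
theorem deviation_complement (hsym : ∀ t, ℓ t 1 + ℓ t (-1) = 1)
    (hrange : ∀ t y, ℓ t y ∈ Set.Icc (0 : ℝ) 1) (hm : ∀ y, Measurable fun t => ℓ t y)
    (q : Measure X) [IsProbabilityMeasure q] {n : ℕ} (hn : 0 < n) {g : X → ℝ} (hg : Measurable g)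
    (x : Fin n → X) :
    deviation q (fun t => ℓ t 1) g x = -deviation q (fun t => ℓ t (-1)) g x := by
  have hi (y : ℤˣ) : Integrable (fun z : X => ℓ (g z) y) q :=
    integrable_of_abs_le ((hm y).comp hg) fun z => abs_le_one_of_mem_Icc (hrange _ _)
  have h₁ : ∫ z, ℓ (g z) 1 ∂q + ∫ z, ℓ (g z) (-1) ∂q = 1 := by
    rw [← integral_add (hi _) (hi _)]
    simp [hsym]
  have h₂ : 1 / (n : ℝ) * ∑ i, ℓ (g (x i)) 1 + 1 / n * ∑ i, ℓ (g (x i)) (-1) = 1 := by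
    rw [← mul_add, ← Finset.sum_add_distrib]
    have : (n : ℝ) ≠ 0 := by positivity
    simp [hsym, this]
  simp only [deviation]
  linarith

theorem measureReal_inter_ge {Ω : Type*} [MeasurableSpace Ω] (μ : Measure Ω)
    [IsProbabilityMeasure μ] {s t : Set Ω} (ht : MeasurableSet t) {a b : ℝ}
    (hs' : 1 - a ≤ μ.real s) (ht' : 1 - b ≤ μ.real t) : 1 - (a + b) ≤ μ.real (s ∩ t) := by
  have h := measureReal_union_add_inter (μ := μ) (s := s) ht
  have := measureReal_le_one (μ := μ) (s := s ∪ t)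
  linarith

/-- Each sample contributes two deviations, hence twice the level `√(l / (2 * n))`. -/
theorem sqrt_two_mul_div (l : ℝ) (n : ℕ) : √(2 * l / n) = 2 * √(l / (2 * n)) := by
  rw [show 2 * l / (n : ℝ) = 2 ^ 2 * (l / (2 * n)) by
    by_cases h : (n : ℝ) = 0
    · simp [h]
    · field_simp, Real.sqrt_mul (by positivity), Real.sqrt_sq (by positivity)]

theorem exp_neg_confidence {n : ℕ} (hn : 0 < n) {δ : ℝ} (hδ : 0 < δ) (hδ₄ : δ ≤ 4) :
    Real.exp (-2 * n * √(Real.log (4 / δ) / (2 * n)) ^ 2) = δ / 4 := by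
  have hl : 0 ≤ Real.log (4 / δ) := Real.log_nonneg ((one_le_div hδ).2 hδ₄)
  rw [Real.sq_sqrt (by positivity),
    show -2 * (n : ℝ) * (Real.log (4 / δ) / (2 * n)) = -Real.log (4 / δ) by
      have : (n : ℝ) ≠ 0 := by positivity
      field_simp,
    Real.exp_neg, Real.exp_log (by positivity), inv_div]

end Risk

/-! ### The estimation error -/

section EstimationError

open PULearning

variable {X : Type u} [MeasurableSpace X] {ρ : Measure (X × ℤˣ)} {ℓ : ℝ → ℤˣ → ℝ}

theorem estimation_error_le {L : ℝ≥0} (hsym : ∀ t, ℓ t 1 + ℓ t (-1) = 1)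
    (hrange : ∀ t y, ℓ t y ∈ Set.Icc (0 : ℝ) 1) (hLip : ∀ y, LipschitzWith L fun t => ℓ t y)
    {G : Set (X → ℝ)} {nP nU : ℕ} (hs : IsPUSetting ρ G nP nU) {gstar : X → ℝ}
    (hg : gstar ∈ G) {δ : ℝ} (hδ : 0 < δ) :
    HoldsWithProbAtLeast (sampleLaw ρ nP nU) (1 - δ) fun S => ∀ ghat : X → ℝ,
      IsMinimizer (empiricalPURisk ℓ (classPrior ρ) S) G ghat →
        risk ℓ ρ ghat - risk ℓ ρ gstar ≤ estimationErrorBound L ρ G nP nU δ := by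
  -- For `δ ≥ 1` the empty event suffices; below, the logarithm is positive.
  rcases le_or_gt 1 δ with hδ₁ | hδ₁
  · exact ⟨∅, MeasurableSet.empty, by simpa using hδ₁, by simp⟩
  have := hs.isProbabilityMeasure
  have := isProbabilityMeasure_posMarginal hs.classPrior_pos
  have hm (y : ℤˣ) : Measurable fun t => ℓ t y := (hLip y).continuous.measurable
  have hGm := hs.pointwiseMeasurable.1
  have hP (y : ℤˣ) := uniform_deviation (posMarginal ρ) hs.pointwiseMeasurable ⟨_, hg⟩
    hs.pos_sample (fun t => hrange t y) (hLip y) hs.rademacher_pos_ne_top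
    (Real.sqrt_nonneg (Real.log (4 / δ) / (2 * nP)))
  have hU (y : ℤˣ) := uniform_deviation (marginal ρ) hs.pointwiseMeasurable ⟨_, hg⟩
    hs.unl_sample (fun t => hrange t y) (hLip y) hs.rademacher_unl_ne_top
    (Real.sqrt_nonneg (Real.log (4 / δ) / (2 * nU)))
  rw [exp_neg_confidence hs.pos_sample hδ (by linarith)] at hP
  rw [exp_neg_confidence hs.unl_sample hδ (by linarith)] at hU
  choose A hAm hAp hA using hP
  choose B hBm hBp hB using hU
  refine ⟨(A 1 ∩ A (-1)) ×ˢ (B 1 ∩ B (-1)),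
    ((hAm 1).inter (hAm _)).prod ((hBm 1).inter (hBm _)), ?_, ?_⟩
  · rw [sampleLaw, measureReal_prod_prod]
    have h₁ := measureReal_inter_ge _ (hAm (-1)) (hAp 1) (hAp (-1))
    have h₂ := measureReal_inter_ge _ (hBm (-1)) (hBp 1) (hBp (-1))
    -- Independence of the two samples gives `(1 - δ / 2) ^ 2 ≥ 1 - δ`.
    nlinarith
  · rintro ⟨x, x'⟩ ⟨⟨hx₁, hx₂⟩, hx'₁, hx'₂⟩ ghat ⟨hghat, hmin⟩
    have hmin := hmin gstar hg
    have hdev (g : X → ℝ) : empiricalPURisk ℓ (classPrior ρ) (x, x') g =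
        -classPrior ρ
          + 2 * classPrior ρ * (∫ x, ℓ (g x) 1 ∂(posMarginal ρ)
            - deviation (posMarginal ρ) (fun t => ℓ t 1) g x)
          + (∫ x, ℓ (g x) (-1) ∂(marginal ρ)
            - deviation (marginal ρ) (fun t => ℓ t (-1)) g x') := by
      simp only [empiricalPURisk, deviation]
      ring
    rw [hdev, hdev] at hmin
    rw [risk_eq hsym hrange hm hs.classPrior_pos (hGm _ hghat),
      risk_eq hsym hrange hm hs.classPrior_pos (hGm _ hg), estimationErrorBound,
      sqrt_two_mul_div, sqrt_two_mul_div]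
    have c₁ := deviation_complement hsym hrange hm (posMarginal ρ) hs.pos_sample (hGm _ hg) x
    have c₂ := deviation_complement hsym hrange hm (marginal ρ) hs.unl_sample (hGm _ hg) x'
    have d₁ := hA 1 x hx₁ ghat hghat
    have d₂ := hA (-1) x hx₂ gstar hg
    have d₃ := hB (-1) x' hx'₂ ghat hghat
    have d₄ := hB 1 x' hx'₁ gstar hg
    -- The positive sample enters with weight `2 * classPrior ρ`: two deviations, each with
    -- complexity constant `2 * L`, give the factor `8`, and the unlabeled sample gives `4`.
    have e₁ := mul_le_mul_of_nonneg_left (add_le_add d₁ d₂) hs.classPrior_pos.le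
    rw [c₁] at hmin
    linarith

end EstimationError

/-! ### Calibration and excess zero-one risk -/

section Calibration

open PULearning

variable {ℓ : ℝ → ℤˣ → ℝ}

theorem zeroOneLoss_add_neg (t : ℝ) : zeroOneLoss t 1 + zeroOneLoss t (-1) = 1 := by
  simp [zeroOneLoss, Real.sign_neg]
  ring

theorem zeroOneLoss_mem_Icc (t : ℝ) (y : ℤˣ) : zeroOneLoss t y ∈ Set.Icc (0 : ℝ) 1 := by
  rcases Real.sign_apply_eq (t * ((y : ℤ) : ℝ)) with h | h | h <;>
    rw [zeroOneLoss, h] <;> norm_num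

theorem measurable_zeroOneLoss (y : ℤˣ) : Measurable fun t => zeroOneLoss t y := by
  have h : Measurable Real.sign := by
    unfold Real.sign
    exact Measurable.ite measurableSet_Iio measurable_const
      (Measurable.ite measurableSet_Ioi measurable_const measurable_const)
  exact ((h.comp (measurable_id.mul_const _)).const_sub 1).div_const 2

theorem zeroOneLoss_of_pos {t : ℝ} (h : 0 < t) : zeroOneLoss t 1 = 0 := by
  simp [zeroOneLoss, Real.sign_of_pos h]

theorem zeroOneLoss_of_neg {t : ℝ} (h : t < 0) : zeroOneLoss t 1 = 1 := by
  simp [zeroOneLoss, Real.sign_of_neg h]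

/-- Up to a constant, the risk of a symmetric loss is the integral of `ℓ (g x) 1` against a signed
density. -/
theorem exists_signed_density {X : Type u} [MeasurableSpace X] (ρ : Measure (X × ℤˣ))
    [IsProbabilityMeasure ρ] :
    ∃ (a : X → ℝ) (K : ℝ), Measurable a ∧ Integrable a (marginal ρ) ∧
      ∀ ℓ : ℝ → ℤˣ → ℝ, (∀ t, ℓ t 1 + ℓ t (-1) = 1) →
        (∀ t y, ℓ t y ∈ Set.Icc (0 : ℝ) 1) → (∀ y, Measurable fun t => ℓ t y) →
        ∀ g : X → ℝ, Measurable g → risk ℓ ρ g = K + ∫ x, a x * ℓ (g x) 1 ∂(marginal ρ) := by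
  -- The unnormalized positive part, so that a zero class prior is allowed; its density `η` is the
  -- conditional probability of the positive label.
  set μ : Measure X := (ρ.restrict {z | z.2 = 1}).map Prod.fst with hμ
  have hac : μ ≪ marginal ρ := Measure.absolutelyContinuous_of_le
    (Measure.map_mono Measure.restrict_le_self measurable_fst)
  set η : X → ℝ := fun x => (μ.rnDeriv (marginal ρ) x).toReal
  have hηm : Measurable η := (Measure.measurable_rnDeriv _ _).ennreal_toReal
  have hηi : Integrable η (marginal ρ) := Measure.integrable_toReal_rnDeriv
  refine ⟨fun x => 2 * η x - 1, ∫ x, (1 - η x) ∂(marginal ρ), (hηm.const_mul 2).sub_const 1,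
    (hηi.const_mul 2).sub (integrable_const 1), fun ℓ hsym hrange hm g hg => ?_⟩
  have hF : Measurable fun x => 2 * ℓ (g x) 1 - 1 := (((hm 1).comp hg).const_mul 2).sub_const 1
  have hb (y : ℤˣ) (x : X) : ‖ℓ (g x) y‖ ≤ 1 := abs_le_one_of_mem_Icc (hrange _ _)
  have hint (y : ℤˣ) : Integrable (fun x => ℓ (g x) y) (marginal ρ) :=
    integrable_of_abs_le ((hm y).comp hg) (hb y)
  have hηℓ : Integrable (fun x => η x * ℓ (g x) 1) (marginal ρ) :=
    hηi.mul_bdd (c := 1) ((hm 1).comp hg).aestronglyMeasurable (ae_of_all _ (hb 1))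
  have hset : ∫ z in {z | z.2 = 1}, (2 * ℓ (g z.1) 1 - 1) ∂ρ =
      ∫ x, η x * (2 * ℓ (g x) 1 - 1) ∂(marginal ρ) := by
    rw [← integral_map (f := fun x => 2 * ℓ (g x) 1 - 1) measurable_fst.aemeasurable
      hF.aestronglyMeasurable, ← hμ, ← integral_rnDeriv_smul hac]
    rfl
  have i₁ : Integrable (fun x => 1 - η x) (marginal ρ) := (integrable_const 1).sub hηi
  have i₂ : Integrable (fun x => η x * (2 * ℓ (g x) 1 - 1)) (marginal ρ) := by
    refine ((hηℓ.const_mul 2).sub hηi).congr (ae_of_all _ fun x => ?_)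
    simp only [Pi.sub_apply]
    ring
  have i₃ : Integrable (fun x => (2 * η x - 1) * ℓ (g x) 1) (marginal ρ) := by
    refine ((hηℓ.const_mul 2).sub (hint 1)).congr (ae_of_all _ fun x => ?_)
    simp only [Pi.sub_apply]
    ring
  rw [risk_eq_integral_add_setIntegral hsym hrange hm hg, hset, ← integral_add (hint _) i₂,
    ← integral_add i₁ i₃]
  refine integral_congr_ae (ae_of_all _ fun x => ?_)
  simp only [eq_sub_of_add_eq' (hsym (g x))]
  ring

/-- A calibration gap yields near-optimal constant predictions that beat every prediction with the
wrong sign by a fixed margin. -/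
theorem exists_margin_of_iInf_lt {f : ℝ → ℝ} (hf : ∀ t, 0 ≤ f t) {p : ℝ → Prop}
    (h : ⨅ t, f t < ⨅ t : {t // p t}, f t) :
    ∃ c > 0, ∀ ε > 0, ∃ s, (∀ t, f s ≤ f t + ε) ∧ ∀ t, p t → f s + c ≤ f t + ε := by
  refine ⟨_, sub_pos.2 h, fun ε hε => ?_⟩
  obtain ⟨s, hs⟩ := exists_lt_of_ciInf_lt (lt_add_of_pos_right (⨅ t, f t) hε)
  refine ⟨s, fun t => ?_, fun t ht => ?_⟩
  · have := ciInf_le (f := f) ⟨0, by rintro _ ⟨t, rfl⟩; exact hf t⟩ t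
    linarith
  · have := ciInf_le (f := fun t : {t // p t} => f t) ⟨0, by rintro _ ⟨t, rfl⟩; exact hf t⟩ ⟨t, ht⟩
    dsimp only at this
    linarith

/-- For a calibrated symmetric loss the excess zero-one risk is at most a constant multiple of the
excess risk. -/
theorem exists_excess_zeroOne_le (hsym : ∀ t, ℓ t 1 + ℓ t (-1) = 1)
    (hrange : ∀ t y, ℓ t y ∈ Set.Icc (0 : ℝ) 1) (hm : ∀ y, Measurable fun t => ℓ t y)
    (hcal : IsClassificationCalibrated ℓ) :
    ∃ c : ℝ, 0 < c ∧ ∀ (X : Type u) [MeasurableSpace X] (ρ : Measure (X × ℤˣ))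
      [IsProbabilityMeasure ρ] (g : X → ℝ), Measurable g →
      c * (risk zeroOneLoss ρ g - bayesRisk zeroOneLoss ρ) ≤ risk ℓ ρ g - bayesRisk ℓ ρ := by
  have e₁ (t : ℝ) : conditionalRisk ℓ 1 t = ℓ t 1 := by simp [conditionalRisk]
  have e₂ (t : ℝ) : conditionalRisk ℓ 0 t = ℓ t (-1) := by simp [conditionalRisk]
  -- At `η = 1` and `η = 0` the conditional risk is `ℓ t 1` and `ℓ t (-1)`.
  obtain ⟨c₁, hc₁, hgap₁⟩ := exists_margin_of_iInf_lt
    (fun t => by rw [e₁]; exact (hrange t 1).1) (hcal 1 (by norm_num) (by norm_num))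
  obtain ⟨c₂, hc₂, hgap₂⟩ := exists_margin_of_iInf_lt
    (fun t => by rw [e₂]; exact (hrange t (-1)).1) (hcal 0 (by norm_num) (by norm_num))
  simp only [e₁] at hgap₁
  simp only [e₂] at hgap₂
  refine ⟨min c₁ c₂, lt_min hc₁ hc₂, fun X _ ρ _ g hg => ?_⟩
  set c := min c₁ c₂
  have hc : 0 < c := lt_min hc₁ hc₂
  obtain ⟨a, K, ham, hai, hrisk⟩ := exists_signed_density ρ
  have hcomp (g' : X → ℝ) (hg' : Measurable g') (ε : ℝ) (hε : 0 < ε) :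
      c * (risk zeroOneLoss ρ g - risk zeroOneLoss ρ g') ≤
        risk ℓ ρ g - bayesRisk ℓ ρ + ε * ∫ x, |a x| ∂(marginal ρ) := by
    obtain ⟨t₁, hopt₁, hmar₁⟩ := hgap₁ ε hε
    obtain ⟨t₂, hopt₂, hmar₂⟩ := hgap₂ ε hε
    -- A nearly Bayes-optimal predictor with two values; the slack `ε` is needed because the infima
    -- may not be attained.
    set h : X → ℝ := fun x => if 0 < a x then t₁ else t₂
    have hhm : Measurable h :=
      Measurable.ite (measurableSet_lt measurable_const ham) measurable_const measurable_const
    have hbayes : bayesRisk ℓ ρ ≤ risk ℓ ρ h :=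
      ciInf_le (f := fun g : {g : X → ℝ // Measurable g} => risk ℓ ρ g)
        ⟨0, by rintro _ ⟨g, rfl⟩; exact integral_nonneg fun z => (hrange _ _).1⟩ ⟨h, hhm⟩
    have hi (ℓ' : ℝ → ℤˣ → ℝ) (hr : ∀ t y, ℓ' t y ∈ Set.Icc (0 : ℝ) 1)
        (hm' : ∀ y, Measurable fun t => ℓ' t y) (f : X → ℝ) (hf : Measurable f) :
        Integrable (fun x => a x * ℓ' (f x) 1) (marginal ρ) :=
      hai.mul_bdd (c := 1) ((hm' 1).comp hf).aestronglyMeasurable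
        (ae_of_all _ fun x => abs_le_one_of_mem_Icc (hr _ _))
    have i₁ := hi _ zeroOneLoss_mem_Icc measurable_zeroOneLoss g hg
    have i₂ := hi _ zeroOneLoss_mem_Icc measurable_zeroOneLoss g' hg'
    have i₃ := hi _ hrange hm g hg
    have i₄ := hi _ hrange hm h hhm
    have hz := hrisk _ zeroOneLoss_add_neg zeroOneLoss_mem_Icc measurable_zeroOneLoss
    have hl := hrisk _ hsym hrange hm
    have hpt : ∫ x, c * (a x * zeroOneLoss (g x) 1 - a x * zeroOneLoss (g' x) 1) ∂(marginal ρ) ≤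
        ∫ x, ((a x * ℓ (g x) 1 - a x * ℓ (h x) 1) + ε * |a x|) ∂(marginal ρ) := by
      refine integral_mono ((i₁.sub i₂).const_mul c) ((i₃.sub i₄).add (hai.abs.const_mul ε))
        fun x => ?_
      have z₁ := zeroOneLoss_mem_Icc (g x) 1
      have z₂ := zeroOneLoss_mem_Icc (g' x) 1
      have hcz (u v : ℝ) (hu : u ≤ 1) (hv : 0 ≤ v) : c * (u - v) ≤ c := by nlinarith
      rcases lt_or_ge 0 (a x) with ha | ha
      · rw [show h x = t₁ from if_pos ha, abs_of_pos ha]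
        have : c * (zeroOneLoss (g x) 1 - zeroOneLoss (g' x) 1) ≤ ℓ (g x) 1 - ℓ t₁ 1 + ε := by
          -- A wrong sign, or `g x = 0`, costs at least the calibration margin, while the zero-one
          -- losses differ by at most `1`. For a correct sign the zero-one loss of `g` is already
          -- minimal.
          rcases le_or_gt (g x) 0 with hx | hx
          · linarith [hcz _ _ z₁.2 z₂.1, hmar₁ (g x) (by linarith), min_le_left c₁ c₂]
          · rw [zeroOneLoss_of_pos hx]
            nlinarith [hopt₁ (g x), z₂.1]
        nlinarith
      · rw [show h x = t₂ from if_neg ha.not_gt, abs_of_nonpos ha]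
        have : c * (zeroOneLoss (g' x) 1 - zeroOneLoss (g x) 1) ≤ ℓ t₂ 1 - ℓ (g x) 1 + ε := by
          have s₁ := hsym t₂
          have s₂ := hsym (g x)
          rcases le_or_gt 0 (g x) with hx | hx
          · linarith [hcz _ _ z₂.2 z₁.1, hmar₂ (g x) (by linarith), min_le_right c₁ c₂]
          · rw [zeroOneLoss_of_neg hx]
            nlinarith [hopt₂ (g x), z₂.2]
        nlinarith
    rw [integral_const_mul, integral_sub i₁ i₂,
      integral_add (f := fun x => a x * ℓ (g x) 1 - a x * ℓ (h x) 1) (i₃.sub i₄)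
        (hai.abs.const_mul ε), integral_sub i₃ i₄, integral_const_mul] at hpt
    rw [hz g hg, hz g' hg', hl g hg]
    rw [hl h hhm] at hbayes
    calc _ = c * (∫ x, a x * zeroOneLoss (g x) 1 ∂(marginal ρ)
          - ∫ x, a x * zeroOneLoss (g' x) 1 ∂(marginal ρ)) := by ring
      _ ≤ _ := by linarith
  have hlim (g' : X → ℝ) (hg' : Measurable g') :
      c * (risk zeroOneLoss ρ g - risk zeroOneLoss ρ g') ≤ risk ℓ ρ g - bayesRisk ℓ ρ := by
    have ht : Tendsto (fun ε : ℝ => risk ℓ ρ g - bayesRisk ℓ ρ + ε * ∫ x, |a x| ∂(marginal ρ))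
        (𝓝[>] 0) (𝓝 (risk ℓ ρ g - bayesRisk ℓ ρ + 0 * ∫ x, |a x| ∂(marginal ρ))) :=
      ((Continuous.tendsto (by fun_prop) 0).mono_left nhdsWithin_le_nhds)
    rw [zero_mul, add_zero] at ht
    exact ge_of_tendsto ht (eventually_mem_nhdsWithin.mono fun ε hε => hcomp g' hg' ε hε)
  have : Nonempty {g : X → ℝ // Measurable g} := ⟨⟨0, measurable_zero⟩⟩
  have hle : risk zeroOneLoss ρ g - (risk ℓ ρ g - bayesRisk ℓ ρ) / c ≤ bayesRisk zeroOneLoss ρ :=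
    le_ciInf fun g' => by
      have := hlim g' g'.2
      rw [mul_comm, ← le_div_iff₀ hc] at this
      linarith
  rw [mul_comm, ← le_div_iff₀ hc]
  linarith

end Calibration


theorem theorem2 (ℓ : ℝ → ℤˣ → ℝ) (L : ℝ≥0)
    (hsym : ∀ t, ℓ t 1 + ℓ t (-1) = 1)
    (hrange : ∀ t y, ℓ t y ∈ Set.Icc (0 : ℝ) 1)
    (hLip : ∀ y, LipschitzWith L (fun t => ℓ t y)) :
    (∀ (X : Type u) [MeasurableSpace X] (ρ : Measure (X × ℤˣ)) (G : Set (X → ℝ)) (nP nU : ℕ),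
      PULearning.IsPUSetting ρ G nP nU →
      ∀ gstar : X → ℝ, PULearning.IsMinimizer (PULearning.risk ℓ ρ) G gstar →
      ∀ δ : ℝ, 0 < δ →
      PULearning.HoldsWithProbAtLeast (PULearning.sampleLaw ρ nP nU) (1 - δ) fun S =>
        ∀ ghat : X → ℝ,
          PULearning.IsMinimizer
            (PULearning.empiricalPURisk ℓ (PULearning.classPrior ρ) S) G ghat →
          PULearning.risk ℓ ρ ghat - PULearning.risk ℓ ρ gstar ≤
            PULearning.estimationErrorBound L ρ G nP nU δ) ∧
    (PULearning.IsClassificationCalibrated ℓ →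
      ∃ φ : ℝ → ℝ, Monotone φ ∧ Continuous φ ∧ φ 0 = 0 ∧
      ∀ (X : Type u) [MeasurableSpace X] (ρ : Measure (X × ℤˣ)) (G : Set (X → ℝ)) (nP nU : ℕ),
      PULearning.IsPUSetting ρ G nP nU →
      ∀ gstar : X → ℝ, PULearning.IsMinimizer (PULearning.risk ℓ ρ) G gstar →
      ∀ δ : ℝ, 0 < δ →
      PULearning.HoldsWithProbAtLeast (PULearning.sampleLaw ρ nP nU) (1 - δ) fun S =>
        ∀ ghat : X → ℝ,
          PULearning.IsMinimizer
            (PULearning.empiricalPURisk ℓ (PULearning.classPrior ρ) S) G ghat →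
          PULearning.risk PULearning.zeroOneLoss ρ ghat
              - PULearning.bayesRisk PULearning.zeroOneLoss ρ ≤
            φ (PULearning.risk ℓ ρ gstar - PULearning.bayesRisk ℓ ρ
              + PULearning.estimationErrorBound L ρ G nP nU δ)) := by
  refine ⟨fun X _ ρ G nP nU hs gstar hg δ hδ =>
    estimation_error_le hsym hrange hLip hs hg.1 hδ, fun hcal => ?_⟩
  obtain ⟨c, hc, hexc⟩ := exists_excess_zeroOne_le.{u} hsym hrange
    (fun y => (hLip y).continuous.measurable) hcal
  have hmono : Monotone fun x : ℝ => c⁻¹ * x := fun x y hxy =>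
    mul_le_mul_of_nonneg_left hxy (inv_nonneg.2 hc.le)
  refine ⟨fun x => c⁻¹ * x, hmono, by fun_prop, mul_zero _,
    fun X _ ρ G nP nU hs gstar hg δ hδ => ?_⟩
  have := hs.isProbabilityMeasure
  obtain ⟨E, hE, hp, hbound⟩ := estimation_error_le hsym hrange hLip hs hg.1 hδ
  refine ⟨E, hE, hp, fun S hS ghat hghat => ?_⟩
  have h₁ := hbound S hS ghat hghat
  have h₂ := hexc X ρ ghat (hs.pointwiseMeasurable.1 _ hghat.1)
  rw [mul_comm, ← le_div_iff₀ hc, div_eq_inv_mul] at h₂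
  exact h₂.trans (hmono (by linarith))
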